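/- Let $M$ be a von Neumann algebra with a faithful normal state $\varphi$ (not assumed tracial), let $n\ge 1$, and let $X=(x_1,\dots,x_n)\in M^n$ be a tuple of self-adjoint elements with $\varphi(x_i)=0$ for all $i$ and $\sum_{i=1}^n\varphi(x_i^2)=n$. Notation. Let $\mathcal P=\mathbb C\langle t_1,\dots,t_n\rangle$ be the algebra of noncommutative polynomials, and let $\partial_j:\mathcal P\to\mathcal P\otimes\mathcal P$ be the derivation with $\partial_j t_i=\delta_{ij}\,1\otimes 1$, for the bimodule structure $P_1\cdot(Q_1\otimes Q_2)\cdot P_2=P_1Q_1\otimes Q_2P_2$. The cyclic gradient of $V\in\mathcal P$ is $\mathcal DV=(\mathcal D_1V,\dots,\mathcal D_nV)$, where $\mathcal D_i=m\circ\sigma\circ\partial_i$ with $m(P\otimes Q)=PQ$ and $\sigma(P\otimes Q)=Q\otimes P$; the Jacobian matrix of $P\in\mathcal P^n$ is $\mathcal JP=(\partial_jP_i)_{i,j}$. Polynomials are evaluated at $X$ in $M$, and elements of $\mathcal P\otimes\mathcal P$ are evaluated in $M\otimes M^{op}$. Put $\langle Y,Z\rangle_\varphi=\sum_i\varphi(y_iz_i^*)$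 on $M^n$ and $\langle A,B\rangle=\sum_{i,j}(\varphi\otimes\varphi^{op})(a_{ij}b_{ij}^*)$ on $M_n(M\otimes M^{op})$, with the induced norms $\|\cdot\|_2$ (also for $M$ and for $M\otimes M^{op}$); the Hilbert space completion of the latter space is $L^2(M_n(M\bar\otimes M^{op}),(\varphi\otimes\varphi^{op})\circ\mathrm{Tr})$. A free Stein kernel for $X$ relative to $V\in\mathcal P$ is an element $A$ of this $L^2$ space such that $\langle[\mathcal DV](X),P(X)\rangle_\varphi=\langle A,[\mathcal JP](X)\rangle$ for all $P\in\mathcal P^n$. The free Stein discrepancy $\Sigma^*(X|V)$ is the infimum of $\|A-(1\otimes1^{op})\otimes I_n\|_2$ over all such $A$. Let $C_{opt}(X)$ be the best constant in the free Poincaré inequality, that is, the infimum of all $C\ge 0$ such that $$\|P(X)-\varphi(P(X))\|_2^2\le C\sum_{i=1}^n\|[\partial_iP](X)\|_2^2\qquad\text{for all }P\in\mathcal P .$$ Claim. Some finite $C$ satisfies the free Poincaré inequality and a free Stein kernel for $X$ relative to $\frac12\sum_{i=1}^n t_i^2$ exists, so that $C_{opt}(X)$ and $\Sigma^*\big(X\,\big|\,\frac12\sum_i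 t_i^2\big)$ are finite, and $$C_{opt}(X)\ \ge\ 1+\frac{\Sigma^*\big(X\,\big|\,\tfrac12\sum_{i=1}^n t_i^2\big)^2}{n}.$$ -/

import Mathlib

open scoped TensorProduct ComplexOrder InnerProductSpace

noncomputable section

namespace FreeStein

/-! ### Noncommutative polynomials and their derivatives -/

/-- The algebra `ℂ⟨t₁, …, tₙ⟩` of noncommutative polynomials in `n` variables. -/
abbrev NCPoly (n : ℕ) : Type := FreeAlgebra ℂ (Fin n)

/-- The variable `tᵢ`. -/
def t {n : ℕ} (i : Fin n) : NCPoly n := FreeAlgebra.ι ℂ i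

/-- Auxiliary homomorphism `P ↦ [[P ⊗ 1, ∂ᵢP], [0, 1 ⊗ P]]` into the upper triangular
matrices over the algebra `ℂ⟨t⟩ ⊗ ℂ⟨t⟩`. That its upper right entry obeys the Leibniz rule is
proved below, in `partialDeriv_mul`. -/
def derivHom {n : ℕ} (i : Fin n) :
    NCPoly n →ₐ[ℂ] Matrix (Fin 2) (Fin 2) (NCPoly n ⊗[ℂ] NCPoly n) :=
  FreeAlgebra.lift ℂ fun j =>
    !![t j ⊗ₜ[ℂ] (1 : NCPoly n), if i = j then 1 else 0; 0, (1 : NCPoly n) ⊗ₜ[ℂ] t j]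

/-- The noncommutative derivative `∂ᵢ : ℂ⟨t⟩ → ℂ⟨t⟩ ⊗ ℂ⟨t⟩`: the unique derivation with
`∂ᵢ tⱼ = δᵢⱼ 1 ⊗ 1` (see `partialDeriv_t`, `partialDeriv_mul`, `partialDeriv_unique`). -/
def partialDeriv {n : ℕ} (i : Fin n) : NCPoly n →ₗ[ℂ] NCPoly n ⊗[ℂ] NCPoly n where
  toFun P := derivHom i P 0 1
  map_add' P Q := by simp
  map_smul' c P := by simp

theorem partialDeriv_t {n : ℕ} (i j : Fin n) :
    partialDeriv i (t j) = if i = j then (1 : NCPoly n) ⊗ₜ[ℂ] (1 : NCPoly n) else 0 := by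
  simp [partialDeriv, derivHom, t, Algebra.TensorProduct.one_def]

theorem derivHom_diag {n : ℕ} (i : Fin n) (P : NCPoly n) :
    derivHom i P 0 0 = P ⊗ₜ[ℂ] 1 ∧ derivHom i P 1 1 = 1 ⊗ₜ[ℂ] P ∧ derivHom i P 1 0 = 0 := by
  induction P using FreeAlgebra.induction with
  | grade0 r =>
    simp [Algebra.algebraMap_eq_smul_one, TensorProduct.smul_tmul',
      Algebra.TensorProduct.one_def]
  | grade1 x => simp [derivHom, t]
  | mul a b ha hb =>
    simp [Matrix.mul_apply, Fin.sum_univ_two, ha, hb]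
  | add a b ha hb => simp [ha, hb, TensorProduct.add_tmul, TensorProduct.tmul_add]

/-- The Leibniz rule `∂ᵢ(PQ) = ∂ᵢ(P) · Q + P · ∂ᵢ(Q)` for the bimodule structure
`P₁ · (Q₁ ⊗ Q₂) · P₂ = (P₁ Q₁) ⊗ (Q₂ P₂)`. -/
theorem partialDeriv_mul {n : ℕ} (i : Fin n) (P Q : NCPoly n) :
    partialDeriv i (P * Q) =
      partialDeriv i P * ((1 : NCPoly n) ⊗ₜ[ℂ] Q) + (P ⊗ₜ[ℂ] (1 : NCPoly n)) * partialDeriv i Q := by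
  simp [partialDeriv, Matrix.mul_apply, Fin.sum_univ_two, derivHom_diag, add_comm]

theorem partialDeriv_unique {n : ℕ} (i : Fin n) (d : NCPoly n →ₗ[ℂ] NCPoly n ⊗[ℂ] NCPoly n)
    (hd : ∀ P Q, d (P * Q) =
      d P * ((1 : NCPoly n) ⊗ₜ[ℂ] Q) + (P ⊗ₜ[ℂ] (1 : NCPoly n)) * d Q)
    (ht : ∀ j, d (t j) = if i = j then (1 : NCPoly n) ⊗ₜ[ℂ] (1 : NCPoly n) else 0) :
    d = partialDeriv i := by
  have h1 : ∀ e : NCPoly n →ₗ[ℂ] NCPoly n ⊗[ℂ] NCPoly n,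
      (∀ P Q, e (P * Q) =
        e P * ((1 : NCPoly n) ⊗ₜ[ℂ] Q) + (P ⊗ₜ[ℂ] (1 : NCPoly n)) * e Q) → e 1 = 0 := by
    intro e he
    have := he 1 1
    simpa [← Algebra.TensorProduct.one_def] using this
  ext P
  induction P using FreeAlgebra.induction with
  | grade0 r =>
    rw [Algebra.algebraMap_eq_smul_one, map_smul, map_smul, h1 d hd,
      h1 (partialDeriv i) (partialDeriv_mul i)]
  | grade1 x => exact (ht x).trans (partialDeriv_t i x).symm
  | mul a b ha hb => rw [hd, partialDeriv_mul, ha, hb]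
  | add a b ha hb => rw [map_add, map_add, ha, hb]

/-- The cyclic derivative `𝒟ᵢ = m ∘ σ ∘ ∂ᵢ`, with `m` the multiplication and `σ` the flip. -/
def cyclicDeriv {n : ℕ} (i : Fin n) : NCPoly n →ₗ[ℂ] NCPoly n :=
  LinearMap.mul' ℂ (NCPoly n) ∘ₗ
    (TensorProduct.comm ℂ (NCPoly n) (NCPoly n)).toLinearMap ∘ₗ partialDeriv i

/-- The quadratic potential `½ ∑ᵢ tᵢ²`. -/
def quadPotential (n : ℕ) : NCPoly n := (1 / 2 : ℂ) • ∑ i : Fin n, t i ^ 2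

/-! ### Von Neumann algebras with a state -/

section State

variable {M : Type*} [CStarAlgebra M] [PartialOrder M]

/-- `φ` is a faithful normal state. Normality: `φ` preserves suprema of upward directed sets of
positive elements. -/
structure IsFaithfulNormalState (φ : M →ₚ[ℂ] ℂ) : Prop where
  map_one : φ 1 = 1
  faithful : ∀ a : M, φ (star a * a) = 0 → a = 0
  normal : ∀ (D : Set M) (s : M), D.Nonempty → DirectedOn (· ≤ ·) D → (∀ a ∈ D, 0 ≤ a) →
    IsLUB D s → IsLUB (φ '' D) (φ s)

/-- The functional `φ ⊗ φᵒᵖ` on the algebraic tensor product `M ⊗ Mᵒᵖ`. -/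
def stateTensor (φ : M →ₚ[ℂ] ℂ) : M ⊗[ℂ] Mᵐᵒᵖ →ₗ[ℂ] ℂ :=
  LinearMap.mul' ℂ ℂ ∘ₗ TensorProduct.map φ.toLinearMap
    (φ.toLinearMap ∘ₗ (MulOpposite.opLinearEquiv ℂ).symm.toLinearMap)

@[simp]
theorem stateTensor_tmul (φ : M →ₚ[ℂ] ℂ) (a : M) (b : Mᵐᵒᵖ) :
    stateTensor φ (a ⊗ₜ[ℂ] b) = φ a * φ b.unop := rfl

end State

section L2

variable {M : Type*} [CStarAlgebra M] [PartialOrder M] [StarOrderedRing M]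

theorem state_star (φ : M →ₚ[ℂ] ℂ) (a : M) : φ (star a) = star (φ a) := map_star φ a

theorem stateTensor_star (φ : M →ₚ[ℂ] ℂ) (A : M ⊗[ℂ] Mᵐᵒᵖ) :
    stateTensor φ (star A) = star (stateTensor φ A) := by
  induction A with
  | zero => simp
  | tmul a b => simp [state_star]
  | add A B hA hB => simp [hA, hB]

/-- The Gram matrix `φ(aₖ aₗ*)` is positive semidefinite. -/
theorem posSemidef_gram {ι : Type*} [Fintype ι] (φ : M →ₚ[ℂ] ℂ) (a : ι → M) :
    (Matrix.of fun k l => φ (a k * star (a l))).PosSemidef := by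
  refine Matrix.PosSemidef.of_dotProduct_mulVec_nonneg ?_ fun x => ?_
  · ext k l
    simp [← state_star]
  · have h : star x ⬝ᵥ (Matrix.of fun k l => φ (a k * star (a l))).mulVec x =
        φ ((∑ k, star (x k) • a k) * star (∑ k, star (x k) • a k)) := by
      rw [star_sum, Finset.sum_mul_sum]
      simp only [dotProduct, Matrix.mulVec, Matrix.of_apply, Pi.star_apply, map_sum,
        Finset.mul_sum, star_smul, star_star, smul_mul_smul_comm, map_smul, smul_eq_mul]
      exact Finset.sum_congr rfl fun k _ => Finset.sum_congr rfl fun l _ => by ring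
    rw [h]
    exact φ.map_nonneg (mul_star_self_nonneg _)

theorem stateTensor_mul_star_nonneg (φ : M →ₚ[ℂ] ℂ) (A : M ⊗[ℂ] Mᵐᵒᵖ) :
    0 ≤ stateTensor φ (A * star A) := by
  obtain ⟨m, a, b, rfl⟩ : ∃ (m : ℕ) (a : Fin m → M) (b : Fin m → Mᵐᵒᵖ),
      A = ∑ k, a k ⊗ₜ[ℂ] b k := by
    induction A with
    | zero => exact ⟨0, Fin.elim0, Fin.elim0, by simp⟩
    | tmul a b => exact ⟨1, fun _ => a, fun _ => b, by simp⟩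
    | add A B hA hB =>
      obtain ⟨m, a, b, rfl⟩ := hA
      obtain ⟨m', a', b', rfl⟩ := hB
      exact ⟨m + m', Fin.append a a', Fin.append b b', by simp [Fin.sum_univ_add]⟩
  have hG := posSemidef_gram φ a
  have hH := (posSemidef_gram φ fun k => star (b k).unop).transpose
  have h := (hG.hadamard hH).dotProduct_mulVec_nonneg (fun _ => 1)
  convert h using 1
  simp [star_sum, Finset.sum_mul_sum, dotProduct, Matrix.mulVec]

set_option linter.unusedVariables false in
/-- The algebraic tensor product `M ⊗ Mᵒᵖ`, equipped below with the inner product of `φ ⊗ φᵒᵖ`. -/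
def PreL2 (φ : M →ₚ[ℂ] ℂ) : Type _ := M ⊗[ℂ] Mᵐᵒᵖ

instance (φ : M →ₚ[ℂ] ℂ) : AddCommGroup (PreL2 φ) := inferInstanceAs (AddCommGroup (M ⊗[ℂ] Mᵐᵒᵖ))
instance (φ : M →ₚ[ℂ] ℂ) : Module ℂ (PreL2 φ) := inferInstanceAs (Module ℂ (M ⊗[ℂ] Mᵐᵒᵖ))

/-- The identity map `M ⊗ Mᵒᵖ → PreL2 φ`. -/
def toPreL2 (φ : M →ₚ[ℂ] ℂ) : M ⊗[ℂ] Mᵐᵒᵖ ≃ₗ[ℂ] PreL2 φ := LinearEquiv.refl ℂ _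

/-- The inner product `⟨A, B⟩ = (φ ⊗ φᵒᵖ)(A · B*)`. Mathlib's inner products are linear in the
second argument, so that `inner B A` is the `⟨A, B⟩` here. -/
abbrev preL2Core (φ : M →ₚ[ℂ] ℂ) : PreInnerProductSpace.Core ℂ (PreL2 φ) where
  inner B A := stateTensor φ ((toPreL2 φ).symm A * star ((toPreL2 φ).symm B))
  conj_inner_symm B A := by
    rw [← Complex.star_def, ← stateTensor_star, star_mul, star_star]
  re_inner_nonneg A := (RCLike.nonneg_iff.mp (stateTensor_mul_star_nonneg φ _)).1
  add_left B B' A := by simp [mul_add]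
  smul_left B A r := by
    rw [map_smul, star_smul, mul_smul_comm, map_smul]
    rfl

instance (φ : M →ₚ[ℂ] ℂ) : SeminormedAddCommGroup (PreL2 φ) :=
  InnerProductSpace.Core.toSeminormedAddCommGroup (c := preL2Core φ)

instance (φ : M →ₚ[ℂ] ℂ) : InnerProductSpace ℂ (PreL2 φ) :=
  InnerProductSpace.ofCore (preL2Core φ)

theorem preL2_inner (φ : M →ₚ[ℂ] ℂ) (A B : M ⊗[ℂ] Mᵐᵒᵖ) :
    ⟪toPreL2 φ B, toPreL2 φ A⟫_ℂ = stateTensor φ (A * star B) := rfl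

/-- The Hilbert space `L²(M ⊗̄ Mᵒᵖ, φ ⊗ φᵒᵖ)`, as the completion of `M ⊗ Mᵒᵖ` (which is dense in it)
for the inner product `⟨A, B⟩ = (φ ⊗ φᵒᵖ)(A · B*)`. -/
abbrev L2 (φ : M →ₚ[ℂ] ℂ) : Type _ := UniformSpace.Completion (PreL2 φ)

/-- The canonical map `M ⊗ Mᵒᵖ → L²(M ⊗̄ Mᵒᵖ, φ ⊗ φᵒᵖ)`. -/
def toL2 (φ : M →ₚ[ℂ] ℂ) (A : M ⊗[ℂ] Mᵐᵒᵖ) : L2 φ := (toPreL2 φ A : UniformSpace.Completion _)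

/-- The Hilbert space `L²(Mₙ(M ⊗̄ Mᵒᵖ), (φ ⊗ φᵒᵖ) ∘ Tr)` of matrices with entries in
`L²(M ⊗̄ Mᵒᵖ, φ ⊗ φᵒᵖ)`; the inner product is the sum of the inner products of the entries. -/
abbrev L2Mat (φ : M →ₚ[ℂ] ℂ) (n : ℕ) : Type _ := PiLp 2 fun _ : Fin n × Fin n => L2 φ

/-- The canonical map `Mₙ(M ⊗ Mᵒᵖ) → L²(Mₙ(M ⊗̄ Mᵒᵖ), (φ ⊗ φᵒᵖ) ∘ Tr)`. -/
def toL2Mat (φ : M →ₚ[ℂ] ℂ) {n : ℕ} (A : Matrix (Fin n) (Fin n) (M ⊗[ℂ] Mᵐᵒᵖ)) : L2Mat φ n :=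
  WithLp.toLp 2 fun ij => toL2 φ (A ij.1 ij.2)

theorem inner_toL2Mat (φ : M →ₚ[ℂ] ℂ) {n : ℕ} (A B : Matrix (Fin n) (Fin n) (M ⊗[ℂ] Mᵐᵒᵖ)) :
    ⟪toL2Mat φ B, toL2Mat φ A⟫_ℂ = ∑ i, ∑ j, stateTensor φ (A i j * star (B i j)) := by
  simp [toL2Mat, toL2, PiLp.inner_apply, Fintype.sum_prod_type, preL2_inner]

/-- The inner product `⟨X, Y⟩_φ = ∑ᵢ φ(xᵢ yᵢ*)` on `Mⁿ`. -/
def innerTuple (φ : M →ₚ[ℂ] ℂ) {n : ℕ} (X Y : Fin n → M) : ℂ := ∑ i, φ (X i * star (Y i))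

/-- The norm `‖x‖₂ = φ(x x*)^{1/2}` on `M`. -/
def norm2 (φ : M →ₚ[ℂ] ℂ) (x : M) : ℝ := √(φ (x * star x)).re

/-! ### Evaluation, Stein kernels and the Poincaré constant -/

/-- The evaluation `P ↦ P(X)`. -/
def ev {n : ℕ} (X : Fin n → M) : NCPoly n →ₐ[ℂ] M := FreeAlgebra.lift ℂ X

/-- The evaluation `Q ↦ Q(X)` of an element of `ℂ⟨t⟩ ⊗ ℂ⟨t⟩`, viewed in `M ⊗ Mᵒᵖ`. -/
def ev₂ {n : ℕ} (X : Fin n → M) : NCPoly n ⊗[ℂ] NCPoly n →ₗ[ℂ] M ⊗[ℂ] Mᵐᵒᵖ :=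
  TensorProduct.map (ev X).toLinearMap
    ((MulOpposite.opLinearEquiv ℂ).toLinearMap ∘ₗ (ev X).toLinearMap)

/-- The evaluated Jacobian matrix `[𝒥P](X)`, with `(i, j)` entry `[∂ⱼPᵢ](X)`. -/
def jacobian {n : ℕ} (X : Fin n → M) (P : Fin n → NCPoly n) :
    Matrix (Fin n) (Fin n) (M ⊗[ℂ] Mᵐᵒᵖ) :=
  Matrix.of fun i j => ev₂ X (partialDeriv j (P i))

/-- `A` is a free Stein kernel for `X` relative to the potential `V`:
`⟨[𝒟V](X), P(X)⟩_φ = ⟨A, [𝒥P](X)⟩` for every `P ∈ ℂ⟨t⟩ⁿ`. -/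
def IsSteinKernel (φ : M →ₚ[ℂ] ℂ) {n : ℕ} (X : Fin n → M) (V : NCPoly n) (A : L2Mat φ n) : Prop :=
  ∀ P : Fin n → NCPoly n,
    innerTuple φ (fun i => ev X (cyclicDeriv i V)) (fun i => ev X (P i)) =
      ⟪toL2Mat φ (jacobian X P), A⟫_ℂ

/-- The free Stein discrepancy `Σ*(X | V) = inf_A ‖A - (1 ⊗ 1) ⊗ Iₙ‖` over all free Stein
kernels `A`. -/
def steinDiscrepancy (φ : M →ₚ[ℂ] ℂ) {n : ℕ} (X : Fin n → M) (V : NCPoly n) : ℝ :=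
  sInf {r : ℝ | ∃ A : L2Mat φ n, IsSteinKernel φ X V A ∧ r = ‖A - toL2Mat φ 1‖}

/-- `X` satisfies the free Poincaré inequality with constant `C`. -/
def FreePoincare (φ : M →ₚ[ℂ] ℂ) {n : ℕ} (X : Fin n → M) (C : ℝ) : Prop :=
  ∀ P : NCPoly n, norm2 φ (ev X P - algebraMap ℂ M (φ (ev X P))) ^ 2 ≤
    C * ∑ i, ‖toL2 φ (ev₂ X (partialDeriv i P))‖ ^ 2

/-- The best possible constant `C_opt(X)` in the free Poincaré inequality. -/
def optPoincareConst (φ : M →ₚ[ℂ] ℂ) {n : ℕ} (X : Fin n → M) : ℝ :=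
  sInf {C : ℝ | 0 ≤ C ∧ FreePoincare φ X C}

end L2

end FreeStein

end

open scoped TensorProduct ComplexOrder InnerProductSpace

namespace FreeStein

/-! ### Evaluated derivatives and the commutator identity. -/

section Evaluation

variable {M : Type*} [CStarAlgebra M]

/-! A Poincaré constant `C` makes `P ↦ ∑ᵢ φ(Pᵢ(X) xᵢ)` bounded by `√(C n)` times the `L²` norm of
the Jacobian: as `φ(xᵢ) = 0`, each `Pᵢ(X)` may be centred, and Cauchy–Schwarz applies. Hahn–Banach
and Riesz (`exists_inner_eq_of_norm_le`) then give a Stein kernel `A` with `‖A‖² ≤ C n`. Testing it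
on `P = t`, whose Jacobian is the identity, gives `⟨A, 1⟩ = n`, hence `‖A - 1‖² ≤ C n - 2n + n = n
(C - 1)`. The infimum over `C` is the claim.

Some finite `C` exists because `P(X) ⊗ 1 - 1 ⊗ P(X)` is a sum of the `[∂ᵢP](X)` multiplied on the
right by `xᵢ ⊗ 1 - 1 ⊗ xᵢ`. For the norm `(φ ⊗ φᵒᵖ)(A A*)` right multiplication is bounded for any
state, so no trace property is needed. -/

theorem ev_t {n : ℕ} (X : Fin n → M) (i : Fin n) : ev X (t i) = X i := by
  simp [ev, t]

theorem ev₂_tmul {n : ℕ} (X : Fin n → M) (P Q : NCPoly n) :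
    ev₂ X (P ⊗ₜ[ℂ] Q) = ev X P ⊗ₜ[ℂ] MulOpposite.op (ev X Q) := rfl

/-- The second leg lands in `Mᵐᵒᵖ`, where products reverse. Both bimodule actions thus become left
multiplications, leaving the right side free for the commutators. -/
theorem ev₂_mul_one_tmul {n : ℕ} (X : Fin n → M) (A : NCPoly n ⊗[ℂ] NCPoly n) (Q : NCPoly n) :
    ev₂ X (A * (1 ⊗ₜ[ℂ] Q)) = (1 ⊗ₜ[ℂ] MulOpposite.op (ev X Q)) * ev₂ X A := by
  induction A with
  | zero => simp
  | tmul a b => simp [ev₂_tmul]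
  | add A B hA hB => rw [add_mul, map_add, hA, hB, map_add, mul_add]

theorem ev₂_tmul_one_mul {n : ℕ} (X : Fin n → M) (P : NCPoly n) (A : NCPoly n ⊗[ℂ] NCPoly n) :
    ev₂ X ((P ⊗ₜ[ℂ] 1) * A) = (ev X P ⊗ₜ[ℂ] 1) * ev₂ X A := by
  induction A with
  | zero => simp
  | tmul a b => simp [ev₂_tmul]
  | add A B hA hB => rw [mul_add, map_add, hA, hB, map_add, mul_add]

theorem partialDeriv_one {n : ℕ} (i : Fin n) : partialDeriv i (1 : NCPoly n) = 0 := by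
  have h := partialDeriv_mul i (1 : NCPoly n) 1
  simpa [← Algebra.TensorProduct.one_def] using h

/-- `P(X) ⊗ 1 - 1 ⊗ P(X) = ∑ᵢ [∂ᵢP](X) (xᵢ ⊗ 1 - 1 ⊗ xᵢ)` in `M ⊗ Mᵒᵖ`. -/
theorem sum_partialDeriv_mul_commutator {n : ℕ} (X : Fin n → M) (P : NCPoly n) :
    ∑ i, ev₂ X (partialDeriv i P) * (X i ⊗ₜ[ℂ] 1 - 1 ⊗ₜ[ℂ] MulOpposite.op (X i)) =
      ev X P ⊗ₜ[ℂ] 1 - 1 ⊗ₜ[ℂ] MulOpposite.op (ev X P) := by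
  induction P using FreeAlgebra.induction with
  | grade0 r =>
    simp [Algebra.algebraMap_eq_smul_one, partialDeriv_one, TensorProduct.smul_tmul']
  | grade1 x =>
    change ∑ i, ev₂ X (partialDeriv i (t x)) * _ = _
    simp only [partialDeriv_t, apply_ite (ev₂ X), map_zero, ite_mul, zero_mul,
      Finset.sum_ite_eq', Finset.mem_univ, if_true, ev₂_tmul, map_one, MulOpposite.op_one]
    rw [← Algebra.TensorProduct.one_def, one_mul, ← ev_t X x]
    rfl
  | mul a b ha hb =>
    -- Telescoping: `(1 ⊗ b)(a ⊗ 1 - 1 ⊗ a) + (a ⊗ 1)(b ⊗ 1 - 1 ⊗ b)`, where the terms `a ⊗ b`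
    -- cancel.
    simp only [partialDeriv_mul, map_add, ev₂_mul_one_tmul, ev₂_tmul_one_mul, add_mul,
      Finset.sum_add_distrib, mul_assoc, ← Finset.mul_sum, ha, hb, map_mul]
    simp [mul_sub]
  | add a b ha hb =>
    simp only [map_add, add_mul, Finset.sum_add_distrib, ha, hb, TensorProduct.add_tmul,
      MulOpposite.op_add, TensorProduct.tmul_add]
    abel

theorem jacobian_t {n : ℕ} (X : Fin n → M) : jacobian X t = 1 := by
  ext i j
  simp only [jacobian, Matrix.of_apply, partialDeriv_t, Matrix.one_apply, eq_comm (a := j),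
    apply_ite (ev₂ X), map_zero, ev₂_tmul, map_one, MulOpposite.op_one,
    Algebra.TensorProduct.one_def]

theorem cyclicDeriv_quadPotential {n : ℕ} (i : Fin n) :
    cyclicDeriv i (quadPotential n) = t i := by
  have h : ∀ j : Fin n, cyclicDeriv i (t j ^ 2) = if i = j then (2 : ℂ) • t i else 0 := by
    intro j
    rw [cyclicDeriv, LinearMap.comp_apply, LinearMap.comp_apply, pow_two, partialDeriv_mul,
      partialDeriv_t]
    split_ifs with hij
    · subst hij; simp [two_smul]
    · simp
  simp [quadPotential, h, smul_smul]

/-- The linear functional `P ↦ ∑ᵢ φ(Pᵢ(X) xᵢ)`. -/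
noncomputable def pairingLinear [PartialOrder M] (φ : M →ₚ[ℂ] ℂ) {n : ℕ} (X : Fin n → M) : (Fin n → NCPoly n) →ₗ[ℂ] ℂ :=
  ∑ i, φ.toLinearMap ∘ₗ LinearMap.mulRight ℂ (X i) ∘ₗ (ev X).toLinearMap ∘ₗ LinearMap.proj i

theorem pairingLinear_apply [PartialOrder M] (φ : M →ₚ[ℂ] ℂ) {n : ℕ} (X : Fin n → M) (P : Fin n → NCPoly n) :
    pairingLinear φ X P = ∑ i, φ (ev X (P i) * X i) := by
  simp [pairingLinear]

end Evaluation

/-- A functional bounded by a linear map into a Hilbert space is represented by a vector. -/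
theorem exists_inner_eq_of_norm_le {E H : Type*} [AddCommGroup E] [Module ℂ E]
    [NormedAddCommGroup H] [InnerProductSpace ℂ H] [CompleteSpace H]
    (J : E →ₗ[ℂ] H) (l : E →ₗ[ℂ] ℂ) {K : ℝ} (hK : 0 ≤ K) (h : ∀ x, ‖l x‖ ≤ K * ‖J x‖) :
    ∃ A : H, ‖A‖ ≤ K ∧ ∀ x, ⟪A, J x⟫_ℂ = l x := by
  have hker : LinearMap.ker J ≤ LinearMap.ker l := fun x hx => by
    have := h x
    rw [LinearMap.mem_ker.mp hx, norm_zero, mul_zero] at this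
    exact norm_le_zero_iff.mp this
  let g : LinearMap.range J →ₗ[ℂ] ℂ :=
    (LinearMap.ker J).liftQ l hker ∘ₗ J.quotKerEquivRange.symm.toLinearMap
  have hg : ∀ x, g ⟨J x, x, rfl⟩ = l x := fun x => by
    have : J.quotKerEquivRange.symm ⟨J x, x, rfl⟩ = (LinearMap.ker J).mkQ x :=
      J.quotKerEquivRange_symm_apply_image x _
    simp [g, this]
  have hbound : ∀ y, ‖g y‖ ≤ K * ‖y‖ := by
    rintro ⟨_, x, rfl⟩
    rw [hg]
    exact h x
  -- The range of `J` need not be closed, so the functional is extended to all of `H` without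
  -- increasing its norm before Riesz applies.
  obtain ⟨f, hf, hfn⟩ := exists_extension_norm_eq _ (g.mkContinuous K hbound)
  refine ⟨(InnerProductSpace.toDual ℂ H).symm f, ?_, fun x => ?_⟩
  · rw [LinearIsometryEquiv.norm_map, hfn]
    exact g.mkContinuous_norm_le hK hbound
  · rw [InnerProductSpace.toDual_symm_apply, ← hg x]
    exact hf ⟨J x, x, rfl⟩

/-! ### A finite constant in the free Poincaré inequality. -/

section Poincare

variable {M : Type*} [CStarAlgebra M] [PartialOrder M] [StarOrderedRing M]

theorem toL2_norm_sq (φ : M →ₚ[ℂ] ℂ) (A : M ⊗[ℂ] Mᵐᵒᵖ) :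
    ‖toL2 φ A‖ ^ 2 = (stateTensor φ (A * star A)).re := by
  rw [toL2, UniformSpace.Completion.norm_coe, ← preL2_inner]
  exact norm_sq_eq_re_inner (𝕜 := ℂ) _

theorem toL2_inner (φ : M →ₚ[ℂ] ℂ) (A B : M ⊗[ℂ] Mᵐᵒᵖ) :
    ⟪toL2 φ B, toL2 φ A⟫_ℂ = stateTensor φ (A * star B) := by
  rw [toL2, toL2, UniformSpace.Completion.inner_coe, preL2_inner]

/-- `toL2` as a linear map. -/
noncomputable def toL2Linear (φ : M →ₚ[ℂ] ℂ) : M ⊗[ℂ] Mᵐᵒᵖ →ₗ[ℂ] L2 φ :=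
  UniformSpace.Completion.toComplL.toLinearMap ∘ₗ (toPreL2 φ).toLinearMap

theorem toL2Linear_apply (φ : M →ₚ[ℂ] ℂ) (A : M ⊗[ℂ] Mᵐᵒᵖ) : toL2Linear φ A = toL2 φ A := rfl

theorem norm2_eq_norm_toL2 {φ : M →ₚ[ℂ] ℂ} (h1 : φ 1 = 1) (a : M) :
    norm2 φ a = ‖toL2 φ (a ⊗ₜ[ℂ] 1)‖ := by
  rw [norm2, ← Real.sqrt_sq (norm_nonneg (toL2 φ _)), toL2_norm_sq]
  simp [h1]

/-- Cauchy–Schwarz for the state `φ`. -/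
theorem norm_state_mul_star_le {φ : M →ₚ[ℂ] ℂ} (h1 : φ 1 = 1) (a b : M) :
    ‖φ (a * star b)‖ ≤ norm2 φ a * norm2 φ b := by
  have h := norm_inner_le_norm (𝕜 := ℂ) (toL2 φ (b ⊗ₜ[ℂ] 1)) (toL2 φ (a ⊗ₜ[ℂ] 1))
  rw [toL2_inner] at h
  rw [norm2_eq_norm_toL2 h1, norm2_eq_norm_toL2 h1, mul_comm]
  simpa [h1] using h

/-- Right multiplication by `z` is bounded by `c` if `z z* + y y* = c²`. -/
theorem norm_toL2_mul_le (φ : M →ₚ[ℂ] ℂ) (A z y : M ⊗[ℂ] Mᵐᵒᵖ) {c : ℝ} (hc : 0 ≤ c)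
    (h : z * star z + y * star y = ((c ^ 2 : ℝ) : ℂ) • 1) :
    ‖toL2 φ (A * z)‖ ≤ c * ‖toL2 φ A‖ := by
  -- The factors `z z*` and `y y*` meet inside `A (z z* + y y*) A*`, so the scalar comes out without
  -- cyclicity of the state.
  have key : ‖toL2 φ (A * z)‖ ^ 2 + ‖toL2 φ (A * y)‖ ^ 2 = c ^ 2 * ‖toL2 φ A‖ ^ 2 := by
    have e : A * z * star (A * z) + A * y * star (A * y) =
        ((c ^ 2 : ℝ) : ℂ) • (A * star A) := by
      have : A * z * star (A * z) + A * y * star (A * y) =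
          A * (z * star z + y * star y) * star A := by
        simp only [star_mul]; noncomm_ring
      rw [this, h, mul_smul_comm, mul_one, smul_mul_assoc]
    rw [toL2_norm_sq, toL2_norm_sq, toL2_norm_sq, ← Complex.add_re, ← map_add, e, map_smul,
      smul_eq_mul, Complex.re_ofReal_mul]
  refine le_of_sq_le_sq ?_ (by positivity)
  rw [mul_pow]
  nlinarith [sq_nonneg ‖toL2 φ (A * y)‖]

/-- Writing the positive defect `‖x‖² - x* x` as a square turns an operator inequality into an
identity, usable in the algebraic tensor product without an order on it. -/
theorem exists_star_mul_add_eq_norm_sq (x : M) :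
    ∃ y : M, star x * x + star y * y = ((‖x‖ ^ 2 : ℝ) : ℂ) • (1 : M) := by
  have h := CStarAlgebra.star_mul_le_algebraMap_norm_sq (a := x)
  rw [← sub_nonneg] at h
  obtain ⟨y, hy⟩ := CStarAlgebra.nonneg_iff_eq_star_mul_self.mp h
  refine ⟨y, ?_⟩
  rw [← hy, add_sub_cancel, Algebra.algebraMap_eq_smul_one, Complex.coe_smul]

theorem norm_toL2_mul_tmul_one_le (φ : M →ₚ[ℂ] ℂ) (A : M ⊗[ℂ] Mᵐᵒᵖ) (x : M) :
    ‖toL2 φ (A * (x ⊗ₜ[ℂ] 1))‖ ≤ ‖x‖ * ‖toL2 φ A‖ := by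
  -- The first leg needs `x x*`, hence the use of `star x`; in the opposite leg the reversed product
  -- calls for `x* x`.
  obtain ⟨y, hy⟩ := exists_star_mul_add_eq_norm_sq (star x)
  rw [norm_star, star_star] at hy
  refine norm_toL2_mul_le φ A _ (star y ⊗ₜ[ℂ] 1) (norm_nonneg x) ?_
  simp only [TensorProduct.star_tmul, Algebra.TensorProduct.tmul_mul_tmul, star_one, mul_one,
    star_star, ← TensorProduct.add_tmul, hy, Algebra.TensorProduct.one_def,
    TensorProduct.smul_tmul']

theorem norm_toL2_mul_one_tmul_le (φ : M →ₚ[ℂ] ℂ) (A : M ⊗[ℂ] Mᵐᵒᵖ) (x : M) :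
    ‖toL2 φ (A * (1 ⊗ₜ[ℂ] MulOpposite.op x))‖ ≤ ‖x‖ * ‖toL2 φ A‖ := by
  obtain ⟨y, hy⟩ := exists_star_mul_add_eq_norm_sq x
  refine norm_toL2_mul_le φ A _ (1 ⊗ₜ[ℂ] MulOpposite.op y) (norm_nonneg x) ?_
  simp only [TensorProduct.star_tmul, Algebra.TensorProduct.tmul_mul_tmul, star_one, mul_one,
    ← MulOpposite.op_star, ← MulOpposite.op_mul, ← MulOpposite.op_add,
    ← TensorProduct.tmul_add, hy, MulOpposite.op_smul, MulOpposite.op_one,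
    Algebra.TensorProduct.one_def, TensorProduct.tmul_smul]

/-- For the centred element `b` the cross terms vanish, and the square of the right side is `φ(b b*)
+ φ(b* b)`. The second term is dropped; without a trace it need not equal the first. -/
theorem norm2_sub_state_le {φ : M →ₚ[ℂ] ℂ} (h1 : φ 1 = 1) (a : M) :
    norm2 φ (a - algebraMap ℂ M (φ a)) ≤
      ‖toL2 φ (a ⊗ₜ[ℂ] 1 - 1 ⊗ₜ[ℂ] MulOpposite.op a)‖ := by
  set b : M := a - algebraMap ℂ M (φ a) with hb
  have hb0 : φ b = 0 := by simp [hb, Algebra.algebraMap_eq_smul_one, h1]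
  have hb0' : φ (star b) = 0 := by rw [state_star, hb0, star_zero]
  have e : a ⊗ₜ[ℂ] 1 - 1 ⊗ₜ[ℂ] MulOpposite.op a =
      b ⊗ₜ[ℂ] (1 : Mᵐᵒᵖ) - 1 ⊗ₜ[ℂ] MulOpposite.op b := by
    simp [hb, TensorProduct.sub_tmul, TensorProduct.tmul_sub, Algebra.algebraMap_eq_smul_one,
      TensorProduct.smul_tmul']
  rw [e, norm2_eq_norm_toL2 h1]
  refine le_of_sq_le_sq ?_ (norm_nonneg _)
  have h2 : 0 ≤ (φ (star b * b)).re :=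
    (Complex.nonneg_iff.mp (φ.map_nonneg (star_mul_self_nonneg b))).1
  rw [toL2_norm_sq, toL2_norm_sq]
  simpa [mul_sub, sub_mul, h1, hb0, hb0'] using h2

theorem freePoincare_of_norm {φ : M →ₚ[ℂ] ℂ} (h1 : φ 1 = 1) {n : ℕ} (X : Fin n → M) :
    FreePoincare φ X (∑ i, (2 * ‖X i‖) ^ 2) := by
  intro P
  have h : norm2 φ (ev X P - algebraMap ℂ M (φ (ev X P))) ≤
      ∑ i, 2 * ‖X i‖ * ‖toL2 φ (ev₂ X (partialDeriv i P))‖ := by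
    refine (norm2_sub_state_le h1 _).trans ?_
    rw [← sum_partialDeriv_mul_commutator, ← toL2Linear_apply, map_sum]
    refine (norm_sum_le _ _).trans (Finset.sum_le_sum fun i _ => ?_)
    rw [mul_sub, map_sub, toL2Linear_apply, toL2Linear_apply]
    refine (norm_sub_le _ _).trans ?_
    linarith [norm_toL2_mul_tmul_one_le φ (ev₂ X (partialDeriv i P)) (X i),
      norm_toL2_mul_one_tmul_le φ (ev₂ X (partialDeriv i P)) (X i)]
  -- Cauchy–Schwarz over `i` turns the factors `2‖xᵢ‖`, one `‖xᵢ‖` from each leg of the commutator,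
  -- into the stated constant.
  exact (pow_le_pow_left₀ (Real.sqrt_nonneg _) h 2).trans
    (Finset.sum_mul_sq_le_sq_mul_sq _ _ _)

end Poincare

/-! ### From a Poincaré constant to a Stein kernel. -/

section SteinKernel

variable {M : Type*} [CStarAlgebra M] [PartialOrder M] [StarOrderedRing M]

/-- The evaluated Jacobian as a linear map into `L²`. -/
noncomputable def jacobianLinear (φ : M →ₚ[ℂ] ℂ) {n : ℕ} (X : Fin n → M) :
    (Fin n → NCPoly n) →ₗ[ℂ] L2Mat φ n :=
  (WithLp.linearEquiv 2 ℂ (Fin n × Fin n → L2 φ)).symm.toLinearMap ∘ₗ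
    LinearMap.pi fun ij => toL2Linear φ ∘ₗ ev₂ X ∘ₗ partialDeriv ij.2 ∘ₗ LinearMap.proj ij.1

theorem jacobianLinear_apply (φ : M →ₚ[ℂ] ℂ) {n : ℕ} (X : Fin n → M) (P : Fin n → NCPoly n) :
    jacobianLinear φ X P = toL2Mat φ (jacobian X P) := rfl

theorem norm_jacobianLinear_sq (φ : M →ₚ[ℂ] ℂ) {n : ℕ} (X : Fin n → M) (P : Fin n → NCPoly n) :
    ‖jacobianLinear φ X P‖ ^ 2 = ∑ i, ∑ j, ‖toL2 φ (ev₂ X (partialDeriv j (P i)))‖ ^ 2 := by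
  rw [PiLp.norm_sq_eq_of_L2, Fintype.sum_prod_type]
  rfl

theorem norm_pairingLinear_le {φ : M →ₚ[ℂ] ℂ} (h1 : φ 1 = 1) {n : ℕ} {X : Fin n → M}
    (hX : ∀ i, IsSelfAdjoint (X i)) (hcentred : ∀ i, φ (X i) = 0)
    (hvar : ∑ i, φ (X i ^ 2) = (n : ℂ)) {C : ℝ} (hC : 0 ≤ C) (hP : FreePoincare φ X C)
    (P : Fin n → NCPoly n) :
    ‖pairingLinear φ X P‖ ≤ √(C * n) * ‖jacobianLinear φ X P‖ := by
  set b : Fin n → M := fun i => ev X (P i) - algebraMap ℂ M (φ (ev X (P i)))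
  have hsum : ‖pairingLinear φ X P‖ ≤ ∑ i, norm2 φ (b i) * norm2 φ (X i) := by
    rw [pairingLinear_apply]
    refine (norm_sum_le _ _).trans (Finset.sum_le_sum fun i _ => ?_)
    -- Subtracting the mean from `Pᵢ(X)` does not change its pairing with `xᵢ`, because `φ(xᵢ) = 0`.
    refine le_of_eq_of_le ?_ (norm_state_mul_star_le h1 (b i) (X i))
    simp [b, (hX i).star_eq, sub_mul, Algebra.algebraMap_eq_smul_one, hcentred]
  have hvar' : ∑ i, norm2 φ (X i) ^ 2 = n := by
    have : ∀ i, norm2 φ (X i) ^ 2 = (φ (X i ^ 2)).re := fun i => by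
      rw [norm2, Real.sq_sqrt (Complex.nonneg_iff.mp
        (φ.map_nonneg (mul_star_self_nonneg (X i)))).1, (hX i).star_eq, pow_two]
    simp_rw [this]
    rw [← Complex.re_sum, hvar, Complex.natCast_re]
  have hb : ∑ i, norm2 φ (b i) ^ 2 ≤ C * ‖jacobianLinear φ X P‖ ^ 2 := by
    rw [norm_jacobianLinear_sq, Finset.mul_sum]
    exact Finset.sum_le_sum fun i _ => hP (P i)
  have hcs := (pow_le_pow_left₀ (norm_nonneg _) hsum 2).trans
    (Finset.sum_mul_sq_le_sq_mul_sq _ _ _)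
  refine le_of_sq_le_sq ?_ (by positivity)
  rw [mul_pow, Real.sq_sqrt (by positivity)]
  rw [hvar'] at hcs
  nlinarith [mul_le_mul_of_nonneg_right hb (Nat.cast_nonneg (α := ℝ) n)]

/-- A free Poincaré inequality with constant `C` yields a free Stein kernel with
`‖A - 1‖² ≤ n (C - 1)`. -/
theorem exists_isSteinKernel_of_freePoincare {φ : M →ₚ[ℂ] ℂ} (h1 : φ 1 = 1) {n : ℕ}
    {X : Fin n → M} (hX : ∀ i, IsSelfAdjoint (X i)) (hcentred : ∀ i, φ (X i) = 0)
    (hvar : ∑ i, φ (X i ^ 2) = (n : ℂ)) {C : ℝ} (hC : 0 ≤ C) (hP : FreePoincare φ X C) :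
    ∃ A : L2Mat φ n, IsSteinKernel φ X (quadPotential n) A ∧
      ‖A - toL2Mat φ 1‖ ^ 2 ≤ n * (C - 1) := by
  obtain ⟨A, hAn, hA⟩ := exists_inner_eq_of_norm_le (jacobianLinear φ X) (pairingLinear φ X)
    (Real.sqrt_nonneg (C * n)) (norm_pairingLinear_le h1 hX hcentred hvar hC hP)
  refine ⟨A, fun P => ?_, ?_⟩
  -- The Stein identity is conjugate-linear in `P`; it is the complex conjugate of the represented
  -- functional.
  · rw [← inner_conj_symm, ← jacobianLinear_apply, hA, pairingLinear_apply, innerTuple, map_sum]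
    refine Finset.sum_congr rfl fun i _ => ?_
    rw [cyclicDeriv_quadPotential, ev_t, ← Complex.star_def, ← state_star, star_mul,
      (hX i).star_eq]
  -- The test tuple `P = t` fixes the cross term through the normalisation `∑ φ(xᵢ²) = n`.
  · have hinner : ⟪A, toL2Mat φ 1⟫_ℂ = n := by
      rw [← jacobian_t X, ← jacobianLinear_apply, hA, pairingLinear_apply, ← hvar]
      simp [ev_t, pow_two]
    have hone : ‖toL2Mat φ (1 : Matrix (Fin n) (Fin n) (M ⊗[ℂ] Mᵐᵒᵖ))‖ ^ 2 = n := by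
      rw [norm_sq_eq_re_inner (𝕜 := ℂ), inner_toL2Mat]
      simp [Matrix.one_apply, Algebra.TensorProduct.one_def, h1, apply_ite]
    have hA2 : ‖A‖ ^ 2 ≤ C * n := by
      have := pow_le_pow_left₀ (norm_nonneg _) hAn 2
      rwa [Real.sq_sqrt (by positivity)] at this
    rw [norm_sub_sq (𝕜 := ℂ), hinner, hone, RCLike.natCast_re]
    linarith

end SteinKernel

end FreeStein

theorem mainTheorem4 {M : Type*} [CStarAlgebra M] [WStarAlgebra M] [PartialOrder M]
    [StarOrderedRing M] (φ : M →ₚ[ℂ] ℂ) (hφ : FreeStein.IsFaithfulNormalState φ)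
    {n : ℕ} (hn : 1 ≤ n) (X : Fin n → M) (hX : ∀ i, IsSelfAdjoint (X i))
    (hcentred : ∀ i, φ (X i) = 0) (hvar : ∑ i, φ (X i ^ 2) = (n : ℂ)) :
    (∃ C : ℝ, 0 ≤ C ∧ FreeStein.FreePoincare φ X C) ∧
    (∃ A : FreeStein.L2Mat φ n, FreeStein.IsSteinKernel φ X (FreeStein.quadPotential n) A) ∧
    1 + FreeStein.steinDiscrepancy φ X (FreeStein.quadPotential n) ^ 2 / n ≤
      FreeStein.optPoincareConst φ X := by
  have hex : ∃ C : ℝ, 0 ≤ C ∧ FreeStein.FreePoincare φ X C :=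
    ⟨_, by positivity, FreeStein.freePoincare_of_norm hφ.map_one X⟩
  -- Nonemptiness from `hex` excludes the default value `sInf ∅ = 0`; it remains to bound each
  -- admissible `C`.
  refine ⟨hex, ?_, le_csInf hex ?_⟩
  · obtain ⟨C, hC, hP⟩ := hex
    obtain ⟨A, hA, -⟩ :=
      FreeStein.exists_isSteinKernel_of_freePoincare hφ.map_one hX hcentred hvar hC hP
    exact ⟨A, hA⟩
  · rintro C ⟨hC, hP⟩
    obtain ⟨A, hA, hle⟩ :=
      FreeStein.exists_isSteinKernel_of_freePoincare hφ.map_one hX hcentred hvar hC hP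
    have h0 : 0 ≤ FreeStein.steinDiscrepancy φ X (FreeStein.quadPotential n) :=
      Real.sInf_nonneg (by rintro _ ⟨B, -, rfl⟩; exact norm_nonneg _)
    have h1 : FreeStein.steinDiscrepancy φ X (FreeStein.quadPotential n) ≤
        ‖A - FreeStein.toL2Mat φ 1‖ :=
      csInf_le ⟨0, by rintro _ ⟨B, -, rfl⟩; exact norm_nonneg _⟩ ⟨A, hA, rfl⟩
    have hn' : (0 : ℝ) < n := by exact_mod_cast hn
    have h2 : FreeStein.steinDiscrepancy φ X (FreeStein.quadPotential n) ^ 2 / n ≤ C - 1 := by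
      rw [div_le_iff₀' hn']
      exact (pow_le_pow_left₀ h0 h1 2).trans hle
    linarith
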